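/- Let $T\ge 0$ and let $X=(X_t)_{t\in[0,T]}$ be a centered Gaussian process with $X_0=0$ almost surely on a probability space $(\Omega,\mathcal F,P)$. Let $(\mathcal F^X_t)_{t\in[0,T]}$ be the filtration generated by $X$ and put $L^2_X=L^2(\Omega,\mathcal F^X_T,P)$. Let $\mathfrak H$ be the Hilbert space obtained by completing the linear span of the indicator functions $\mathbf 1_{(0,t]}$, $t\in[0,T]$, with respect to the (possibly degenerate) inner product determined by $\langle \mathbf 1_{(0,t]},\mathbf 1_{(0,s]}\rangle_{\mathfrak H}=E[X_tX_s]$ (step functions of norm zero being identified with $0$), and let $I:\mathfrak H\to L^2_X$ be the linear isometry with $I(\mathbf 1_{(0,t]})=X_t$. For $\xi\in L^2_X$ and $\mathfrak h\in\mathfrak H$ define the $S$-transform $$(S\xi)(\mathfrak h)=E\Big[\xi\,\exp\big(I(\mathfrak h)-\tfrac12E[I(\mathfrak h)^2]\big)\Big].$$ Assume that $X$ has an indefinite Wiener integral, i.e. for every $r\in[0,T]$ there is a continuous linear operator $\mathcal I_r:\mathfrak H\to\mathfrak H$ with $\mathcal I_r(\mathbf 1_{(0,t]})=\mathbf 1_{(0,t\wedge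 r]}$ for all $t\in[0,T]$ (it is then unique); let $\mathcal I_r^*$ be its adjoint. For $r\in[0,T]$ and $\mathfrak c\in\mathfrak H$ let $$D_r^{\mathfrak c}=\big\{\xi\in L^2_X:\ \exists\,\eta\in L^2_X\ \ \forall\,\mathfrak h\in\mathfrak H:\ (S\xi)\big(\mathcal I_r^*(\mathfrak h+\mathfrak c)-\mathfrak c\big)=(S\eta)(\mathfrak h)\big\}$$ be the domain of the $\mathfrak c$-shifted quasi-conditional expectation. Then the following are equivalent: (i) $X$ is not a martingale (with respect to $(\mathcal F^X_t)_{t\in[0,T]}$); (ii) for every $\mathfrak c\in\mathfrak H$ there is an $r\in[0,T]$ such that $D_r^{\mathfrak c}\subsetneq L^2_X$. -/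

import Mathlib

open MeasureTheory ProbabilityTheory

noncomputable section

/-- A centered Gaussian process `X = (X_t)` indexed by the compact interval `[0, T]`, with
`X_0 = 0` almost surely. -/
structure CenteredGaussianProcess {Ω : Type*} [MeasurableSpace Ω] (μ : Measure Ω) (T : ℝ) where
  /-- the random variables `X_t`, `0 ≤ t ≤ T` -/
  val : Set.Icc (0 : ℝ) T → Ω → ℝ
  nonneg : 0 ≤ T
  measurable : ∀ t, Measurable (val t)
  gaussian : IsGaussianProcess val μ
  centered : ∀ t, ∫ ω, val t ω ∂μ = 0
  start_zero : val ⟨0, le_refl 0, nonneg⟩ =ᵐ[μ] 0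

/-- The indicator function `1_{(0,t]}`. -/
def indicatorIoc (t : ℝ) : ℝ → ℝ := Set.indicator (Set.Ioc 0 t) (fun _ => 1)

/-- The linear span of the indicator functions `1_{(0,t]}`, `t ∈ [0, T]`. -/
def stepFunctions (T : ℝ) : Submodule ℝ (ℝ → ℝ) :=
  Submodule.span ℝ (Set.range fun t : Set.Icc (0 : ℝ) T => indicatorIoc t)

/-- `1_{(0,t]}` as an element of the space of step functions. -/
def stepIndicator {T : ℝ} (t : Set.Icc (0 : ℝ) T) : stepFunctions T :=
  ⟨indicatorIoc t, Submodule.subset_span ⟨t, rfl⟩⟩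

/-- The functions `1_{(0,t]}`, `t > 0`, are linearly independent. -/
lemma eq_zero_of_linearCombination_indicatorIoc {T : ℝ} (a : Set.Icc (0 : ℝ) T →₀ ℝ)
    (ha : Finsupp.linearCombination ℝ (fun t : Set.Icc (0 : ℝ) T => indicatorIoc t) a = 0)
    (t : Set.Icc (0 : ℝ) T) (ht : 0 < (t : ℝ)) : a t = 0 := by
  classical
  by_contra hne
  have hmem : t ∈ a.support := Finsupp.mem_support_iff.2 hne
  obtain ⟨m, hm, hmax⟩ := a.support.exists_max_image (fun s => (s : ℝ)) ⟨t, hmem⟩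
  have hm0 : 0 < (m : ℝ) := ht.trans_le (hmax t hmem)
  have h := congrFun ha (m : ℝ)
  rw [Finsupp.linearCombination_apply, Finsupp.sum, Finset.sum_apply,
    Finset.sum_eq_single m] at h
  · simp only [indicatorIoc, Pi.smul_apply, Pi.zero_apply, smul_eq_mul] at h
    rw [Set.indicator_of_mem (Set.mem_Ioc.2 ⟨hm0, le_refl _⟩), mul_one] at h
    exact Finsupp.mem_support_iff.1 hm h
  · intro s hs hsm
    have hlt : (s : ℝ) < m := lt_of_le_of_ne (hmax s hs) fun h => hsm (Subtype.ext h)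
    simp only [indicatorIoc, Pi.smul_apply, smul_eq_mul]
    rw [Set.indicator_of_notMem (fun h => absurd h.2 (not_le.2 hlt)), mul_zero]
  · exact fun h => absurd hm h

namespace CenteredGaussianProcess

variable {Ω : Type*} [MeasurableSpace Ω] {μ : Measure Ω} {T : ℝ}

lemma memLp (X : CenteredGaussianProcess μ T) (t : Set.Icc (0 : ℝ) T) : MemLp (X.val t) 2 μ :=
  (X.gaussian.hasGaussianLaw_eval t).memLp_two

/-- `X_t` as an element of `L²(Ω, P)`. -/
def toL2 (X : CenteredGaussianProcess μ T) (t : Set.Icc (0 : ℝ) T) : Lp ℝ 2 μ :=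
  (X.memLp t).toLp (X.val t)

/-- The covariance function `R(t, s) = E[X_t X_s]`. -/
def covariance (X : CenteredGaussianProcess μ T) (t s : Set.Icc (0 : ℝ) T) : ℝ :=
  ∫ ω, X.val t ω * X.val s ω ∂μ

/-- The filtration `(F_t^X)` generated by `X`. -/
def filtration (X : CenteredGaussianProcess μ T) :
    Filtration (Set.Icc (0 : ℝ) T) ‹MeasurableSpace Ω› :=
  Filtration.natural X.val fun t => (X.measurable t).stronglyMeasurable

/-- `X` is a martingale with respect to its own filtration. -/
def IsMartingale (X : CenteredGaussianProcess μ T) : Prop :=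
  Martingale X.val X.filtration μ

/-- `L²_X = L²(Ω, F_T^X, P)`, as a subspace of `L²(Ω, P)`. -/
def L2X (X : CenteredGaussianProcess μ T) : Submodule ℝ (Lp ℝ 2 μ) :=
  lpMeas ℝ ℝ (X.filtration ⟨T, X.nonneg, le_refl T⟩) 2 μ

/-- The assignment `1_{(0,t]} ↦ X_t` extends linearly to the step functions. -/
lemma exists_stepIntegral (X : CenteredGaussianProcess μ T) :
    ∃ J : stepFunctions T →ₗ[ℝ] Lp ℝ 2 μ, ∀ t, J (stepIndicator t) = X.toL2 t := by
  classical
  let Φ := Finsupp.linearCombination ℝ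
    (fun t : Set.Icc (0 : ℝ) T => (stepIndicator t : stepFunctions T))
  let Ψ := Finsupp.linearCombination ℝ X.toL2
  have hker : LinearMap.ker Φ ≤ LinearMap.ker Ψ := by
    intro a ha
    rw [LinearMap.mem_ker] at ha ⊢
    have ha' : Finsupp.linearCombination ℝ
        (fun t : Set.Icc (0 : ℝ) T => indicatorIoc t) a = 0 := by
      have h := congrArg (stepFunctions T).subtype ha
      rw [map_zero, Finsupp.apply_linearCombination] at h
      exact h
    change Finsupp.linearCombination ℝ X.toL2 a = 0
    rw [Finsupp.linearCombination_apply, Finsupp.sum]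
    refine Finset.sum_eq_zero fun t _ => ?_
    rcases t.2.1.eq_or_lt with h0 | hpos
    · have ht : t = ⟨0, le_refl 0, X.nonneg⟩ := Subtype.ext h0.symm
      have hz : X.toL2 t = 0 := by
        rw [ht, toL2]
        exact (MemLp.toLp_eq_toLp_iff _ (MemLp.zero' (ε := ℝ))).2 X.start_zero
      rw [hz, smul_zero]
    · rw [eq_zero_of_linearCombination_indicatorIoc a ha' t hpos, zero_smul]
  have hsurj : Function.Surjective Φ := by
    rw [← LinearMap.range_eq_top, Finsupp.range_linearCombination]
    have hr : Set.range (fun t : Set.Icc (0 : ℝ) T => (stepIndicator t : stepFunctions T)) =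
        Subtype.val ⁻¹' (Set.range fun t : Set.Icc (0 : ℝ) T => indicatorIoc t) := by
      ext f
      simp [stepIndicator, Subtype.ext_iff]
    rw [hr]
    exact Submodule.span_span_coe_preimage
  refine ⟨((LinearMap.ker Φ).liftQ Ψ hker).comp
    (Φ.quotKerEquivOfSurjective hsurj).symm.toLinearMap, fun t => ?_⟩
  have h1 : (Φ.quotKerEquivOfSurjective hsurj).symm (stepIndicator t) =
      Submodule.Quotient.mk (Finsupp.single t 1) := by
    rw [LinearEquiv.symm_apply_eq]
    simp [Φ]
  simp only [LinearMap.comp_apply, LinearEquiv.coe_coe]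
  rw [h1, Submodule.liftQ_apply]
  simp [Ψ]

/-- The integral of step functions: the linear map with `1_{(0,t]} ↦ X_t`. -/
def stepIntegral (X : CenteredGaussianProcess μ T) : stepFunctions T →ₗ[ℝ] Lp ℝ 2 μ :=
  X.exists_stepIntegral.choose

lemma stepIntegral_indicator (X : CenteredGaussianProcess μ T) (t : Set.Icc (0 : ℝ) T) :
    X.stepIntegral (stepIndicator t) = X.toL2 t :=
  X.exists_stepIntegral.choose_spec t

/-- The span of the indicator functions `1_{(0,t]}`, equipped with the (semi-definite) inner
product determined by `⟨1_{(0,t]}, 1_{(0,s]}⟩ = R(t, s)`, see `inner_indicator` below. -/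
def Step (_X : CenteredGaussianProcess μ T) : Type := stepFunctions T

instance (X : CenteredGaussianProcess μ T) : SeminormedAddCommGroup X.Step :=
  SeminormedAddCommGroup.induced (stepFunctions T) (Lp ℝ 2 μ) X.stepIntegral

instance (X : CenteredGaussianProcess μ T) : InnerProductSpace ℝ X.Step :=
  InnerProductSpace.induced X.stepIntegral

/-- The space of deterministic integrands associated to `X`: the Hilbert space completion of the
span of the indicator functions `1_{(0,t]}`, where step functions of norm zero are identified
with zero. -/
abbrev Integrands (X : CenteredGaussianProcess μ T) : Type :=
  UniformSpace.Completion X.Step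

/-- `1_{(0,t]}` as an element of the space of deterministic integrands. -/
def indicator (X : CenteredGaussianProcess μ T) (t : Set.Icc (0 : ℝ) T) : X.Integrands :=
  UniformSpace.Completion.toComplₗᵢ (𝕜 := ℝ) (show X.Step from stepIndicator t)

/-- The defining formula of the inner product on the space of deterministic integrands. -/
lemma inner_indicator (X : CenteredGaussianProcess μ T) (t s : Set.Icc (0 : ℝ) T) :
    inner ℝ (X.indicator t) (X.indicator s) = X.covariance t s := by
  rw [indicator, indicator, LinearIsometry.inner_map_map]
  change inner ℝ (X.stepIntegral (stepIndicator t)) (X.stepIntegral (stepIndicator s)) = _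
  rw [stepIntegral_indicator, stepIntegral_indicator, L2.inner_def, covariance]
  refine integral_congr_ae ?_
  filter_upwards [(X.memLp t).coeFn_toLp, (X.memLp s).coeFn_toLp] with ω h1 h2
  simp only [toL2, h1, h2, RCLike.inner_apply, conj_trivial, mul_comm]

/-- The integral of step functions as a linear isometry. -/
def stepIsometry (X : CenteredGaussianProcess μ T) : X.Step →ₗᵢ[ℝ] Lp ℝ 2 μ where
  toLinearMap := X.stepIntegral
  norm_map' _ := rfl

/-- The Wiener integral `I`: the continuous linear extension of `1_{(0,t]} ↦ X_t` to the space of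
deterministic integrands. -/
def wienerIntegral (X : CenteredGaussianProcess μ T) : X.Integrands →L[ℝ] Lp ℝ 2 μ :=
  X.stepIsometry.toContinuousLinearMap.extend UniformSpace.Completion.toComplL

lemma wienerIntegral_indicator (X : CenteredGaussianProcess μ T) (t : Set.Icc (0 : ℝ) T) :
    X.wienerIntegral (X.indicator t) = X.toL2 t := by
  rw [← X.stepIntegral_indicator t]
  exact ContinuousLinearMap.extend_eq (e := UniformSpace.Completion.toComplL (𝕜 := ℝ))
    X.stepIsometry.toContinuousLinearMap
    UniformSpace.Completion.denseRange_coe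
    (UniformSpace.Completion.isUniformInducing_coe X.Step) _

/-- The Wiener integral is an isometry. -/
lemma norm_wienerIntegral (X : CenteredGaussianProcess μ T) (h : X.Integrands) :
    ‖X.wienerIntegral h‖ = ‖h‖ := by
  refine UniformSpace.Completion.induction_on h (isClosed_eq (by fun_prop) (by fun_prop)) fun a => ?_
  have : X.wienerIntegral (a : UniformSpace.Completion X.Step) = X.stepIsometry a :=
    ContinuousLinearMap.extend_eq (e := UniformSpace.Completion.toComplL (𝕜 := ℝ))
    X.stepIsometry.toContinuousLinearMap
    UniformSpace.Completion.denseRange_coe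
    (UniformSpace.Completion.isUniformInducing_coe X.Step) _
  rw [this, X.stepIsometry.norm_map, UniformSpace.Completion.norm_coe]

/-- The indicators are total, so a continuous linear operator is determined by its values on them. -/
lemma topologicalClosure_span_indicator (X : CenteredGaussianProcess μ T) :
    (Submodule.span ℝ (Set.range X.indicator)).topologicalClosure = ⊤ := by
  have key : ∀ f : X.Step, ((f : X.Step) : UniformSpace.Completion X.Step) ∈
      Submodule.span ℝ (Set.range X.indicator) := by
    rintro ⟨f, hf⟩
    induction hf using Submodule.span_induction with
    | mem x h =>
      obtain ⟨t, rfl⟩ := h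
      exact Submodule.subset_span ⟨t, rfl⟩
    | zero =>
      have := (UniformSpace.Completion.toComplₗᵢ (𝕜 := ℝ) (E := X.Step)).map_zero
      exact (congrArg (· ∈ Submodule.span ℝ (Set.range X.indicator)) this).mpr (Submodule.zero_mem _)
    | add x y hx hy ihx ihy =>
      have := (UniformSpace.Completion.toComplₗᵢ (𝕜 := ℝ) (E := X.Step)).map_add ⟨x,hx⟩ ⟨y,hy⟩
      have h2 := Submodule.add_mem _ ihx ihy
      exact (congrArg (· ∈ Submodule.span ℝ (Set.range X.indicator)) this).mpr h2
    | smul a x hx ih =>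
      have := (UniformSpace.Completion.toComplₗᵢ (𝕜 := ℝ) (E := X.Step)).map_smul a ⟨x,hx⟩
      have h2 := Submodule.smul_mem _ a ih
      exact (congrArg (· ∈ Submodule.span ℝ (Set.range X.indicator)) this).mpr h2
  rw [eq_top_iff]
  intro x _
  have := UniformSpace.Completion.denseRange_coe (α := X.Step) x
  exact closure_mono (by rintro _ ⟨f, rfl⟩; exact key f) this

/-- The Wick exponential `exp(h - E[h²] / 2)` of a random variable `h`. -/
def wickExp (μ : Measure Ω) (h : Ω → ℝ) (ω : Ω) : ℝ :=
  Real.exp (h ω - (1 / 2) * ∫ ω', h ω' ^ 2 ∂μ)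

/-- The `S`-transform `(S ξ)(h) = E[ξ e^{⋄ I(h)}]`. -/
def sTransform (X : CenteredGaussianProcess μ T) (ξ : Lp ℝ 2 μ) (h : X.Integrands) : ℝ :=
  ∫ ω, ξ ω * wickExp μ (X.wienerIntegral h) ω ∂μ

/-- `X` has an indefinite Wiener integral: for every `r ∈ [0, T]` there is a continuous linear
operator on the space of deterministic integrands mapping `1_{(0,t]}` to `1_{(0,t ∧ r]}` for all
`t ∈ [0, T]`. -/
def HasIndefiniteWienerIntegral (X : CenteredGaussianProcess μ T) : Prop :=
  ∀ r : Set.Icc (0 : ℝ) T, ∃ A : X.Integrands →L[ℝ] X.Integrands,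
    ∀ t, A (X.indicator t) = X.indicator (min t r)

/-- The operator `I_r` on the space of deterministic integrands with
`I_r 1_{(0,t]} = 1_{(0,t ∧ r]}`. -/
def truncation (X : CenteredGaussianProcess μ T) (hX : X.HasIndefiniteWienerIntegral)
    (r : Set.Icc (0 : ℝ) T) : X.Integrands →L[ℝ] X.Integrands :=
  (hX r).choose

lemma truncation_indicator (X : CenteredGaussianProcess μ T)
    (hX : X.HasIndefiniteWienerIntegral) (r t : Set.Icc (0 : ℝ) T) :
    X.truncation hX r (X.indicator t) = X.indicator (min t r) :=
  (hX r).choose_spec t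

/-- The domain `D_r^c ⊆ L²_X` of the `c`-shifted quasi-conditional expectation at `r`: those
`ξ ∈ L²_X` for which there is `η ∈ L²_X` with `(S ξ)((h + c)^r - c) = (S η)(h)` for all `h`, where
`h^r = I_r^* h` is given by the adjoint of `I_r`. -/
def shiftedDomain (X : CenteredGaussianProcess μ T) (hX : X.HasIndefiniteWienerIntegral)
    (r : Set.Icc (0 : ℝ) T) (c : X.Integrands) : Set (Lp ℝ 2 μ) :=
  {ξ | ξ ∈ X.L2X ∧ ∃ η ∈ X.L2X, ∀ h : X.Integrands,
    X.sTransform ξ (ContinuousLinearMap.adjoint (X.truncation hX r) (h + c) - c) =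
      X.sTransform η h}

end CenteredGaussianProcess

end

noncomputable section

namespace CenteredGaussianProcess

variable {Ω : Type*} [MeasurableSpace Ω] {μ : Measure Ω} {T : ℝ}

/-! ### The law of Wiener integrals -/

/-! Write `e(h)` for the Wick exponential of `I(h)`. Then `⟨e(h), e(k)⟩ = exp ⟨h, k⟩`, and the
S-transform is `(S ξ)(h) = ⟨e(h), ξ⟩`. Let `A` be the truncation at `r` and `B` its adjoint.

Suppose `D_r^c` is all of `L²_X`. The functionals `exp(-‖h‖²/2) e(B(h + c) - c)` are then pointwise
bounded in `h`, hence uniformly bounded by Banach–Steinhaus. So `‖B(h + c) - c‖² - ‖h‖²` is bounded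
above. Comparing quadratic growth along rays gives `‖B‖ ≤ 1` whatever `c` is, so `A` is a
contraction (`norm_truncation_le_of_shiftedDomain_eq`). As `A` fixes `1_{(0,s]}` for `s ≤ r` and
kills `1_{(r,t]}`, these must be orthogonal. If this holds for every `r`, increments are
uncorrelated with the past, hence independent of it by joint Gaussianity, and `X` is a martingale
(`isMartingale_iff_inner`).

If `X` is a martingale, `A` is self-adjoint and `E[e(h) | F_r] = e(A h)`
(`condExp_wickL2_of_isMartingale`). For `c = 0` the choice `η = E[ξ | F_r]` then works for every `ξ`
and `r`. -/

lemma inner_wienerIntegral (X : CenteredGaussianProcess μ T) (h k : X.Integrands) :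
    inner ℝ (X.wienerIntegral h) (X.wienerIntegral k) = inner ℝ h k :=
  LinearIsometry.inner_map_map (⟨X.wienerIntegral.toLinearMap, X.norm_wienerIntegral⟩ :
    X.Integrands →ₗᵢ[ℝ] Lp ℝ 2 μ) h k

lemma integral_wienerIntegral_mul (X : CenteredGaussianProcess μ T) (h k : X.Integrands) :
    ∫ ω, X.wienerIntegral h ω * X.wienerIntegral k ω ∂μ = inner ℝ h k := by
  rw [← X.inner_wienerIntegral, L2.inner_def]
  simp [mul_comm]

lemma integral_wienerIntegral_sq (X : CenteredGaussianProcess μ T) (h : X.Integrands) :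
    ∫ ω, X.wienerIntegral h ω ^ 2 ∂μ = ‖h‖ ^ 2 := by
  simp_rw [sq, X.integral_wienerIntegral_mul, real_inner_self_eq_norm_mul_norm]

lemma wienerIntegral_indicator_ae (X : CenteredGaussianProcess μ T) (t : Set.Icc (0 : ℝ) T) :
    X.wienerIntegral (X.indicator t) =ᵐ[μ] X.val t := by
  rw [X.wienerIntegral_indicator]
  exact (X.memLp t).coeFn_toLp

lemma dense_span_indicator (X : CenteredGaussianProcess μ T) :
    Dense (Submodule.span ℝ (Set.range X.indicator) : Set X.Integrands) :=
  Submodule.dense_iff_topologicalClosure_eq_top.2 X.topologicalClosure_span_indicator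

lemma Lp_coeFn_sum_smul {ι : Type*} (s : Finset ι) (a : ι → ℝ) (f : ι → Lp ℝ 2 μ) :
    ⇑(∑ i ∈ s, a i • f i) =ᵐ[μ] fun ω => ∑ i ∈ s, a i * f i ω := by
  filter_upwards [Lp.coeFn_finsetSum s fun i => a i • f i,
    (Filter.eventually_all_finset s).2 fun i _ => Lp.coeFn_smul (a i) (f i)] with ω h1 h2
  rw [h1, Finset.sum_apply]
  exact Finset.sum_congr rfl fun i hi => by simp [h2 i hi]

lemma map_eq_gaussianReal_of_mem_span (X : CenteredGaussianProcess μ T) {h : X.Integrands}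
    (hh : h ∈ Submodule.span ℝ (Set.range X.indicator)) :
    μ.map (X.wienerIntegral h) = gaussianReal 0 (‖h‖ ^ 2).toNNReal := by
  obtain ⟨a, rfl⟩ := (Finsupp.mem_span_range_iff_exists_finsupp).1 hh
  set h := a.sum fun t c => c • X.indicator t with hdef
  have hae : (fun ω => ∑ t ∈ a.support, a t • X.val t ω) =ᵐ[μ] X.wienerIntegral h := by
    have h0 : X.wienerIntegral h = ∑ t ∈ a.support, a t • X.wienerIntegral (X.indicator t) := by
      simp [hdef, Finsupp.sum]
    rw [h0]
    filter_upwards [Lp_coeFn_sum_smul a.support a fun t => X.wienerIntegral (X.indicator t),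
      (Filter.eventually_all_finset a.support).2 fun t _ => X.wienerIntegral_indicator_ae t]
      with ω h1 h2
    rw [h1]
    exact Finset.sum_congr rfl fun t ht => by simp [h2 t ht]
  have hG : HasGaussianLaw (X.wienerIntegral h) μ :=
    ((X.gaussian.smul a).hasGaussianLaw_fun_sum (I := a.support)).congr hae
  have hmean : ∫ ω, X.wienerIntegral h ω ∂μ = 0 := by
    rw [← integral_congr_ae hae, integral_finsetSum _ fun t _ =>
      ((X.gaussian.hasGaussianLaw_eval t).integrable.fun_smul (a t))]
    exact Finset.sum_eq_zero fun t _ => by rw [integral_smul, X.centered, smul_zero]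
  rw [hG.map_eq_gaussianReal, variance_of_integral_eq_zero hG.aemeasurable hmean, hmean,
    X.integral_wienerIntegral_sq]

/-- Since `|e^{isx} - e^{isy}| ≤ |s| |x - y|` and the `L¹` norm is at most the `L²` norm,
characteristic functions are Lipschitz on `L²`. This carries Gaussianity from the span of the
indicators to its completion. -/
lemma continuous_integral_exp_wienerIntegral [IsProbabilityMeasure μ]
    (X : CenteredGaussianProcess μ T) (s : ℝ) :
    Continuous fun h : X.Integrands => ∫ ω, Complex.exp (s * X.wienerIntegral h ω * Complex.I) ∂μ := by
  have hint : ∀ f : Lp ℝ 2 μ, Integrable (fun ω => Complex.exp (s * f ω * Complex.I)) μ := by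
    intro f
    refine Integrable.of_bound (C := 1) ?_ (Filter.Eventually.of_forall fun ω => ?_)
    · exact (by fun_prop : Continuous fun x : ℝ => Complex.exp (s * x * Complex.I)).comp_aestronglyMeasurable
        (Lp.aestronglyMeasurable f)
    · rw [← Complex.ofReal_mul, Complex.norm_exp_ofReal_mul_I]
  have hlip : LipschitzWith ‖s‖₊ fun f : Lp ℝ 2 μ => ∫ ω, Complex.exp (s * f ω * Complex.I) ∂μ := by
    refine LipschitzWith.of_dist_le_mul fun f g => ?_
    have h1 : Integrable (f - g : Lp ℝ 2 μ) μ := (Lp.memLp (f - g)).integrable (by norm_num)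
    have hbound : ∀ x y : ℝ, ‖Complex.exp (s * x * Complex.I) - Complex.exp (s * y * Complex.I)‖ ≤
        |s| * ‖x - y‖ := by
      intro x y
      have : Complex.exp (s * x * Complex.I) - Complex.exp (s * y * Complex.I) =
          Complex.exp (((s * y : ℝ) : ℂ) * Complex.I) *
            (Complex.exp (Complex.I * ((s * (x - y) : ℝ) : ℂ)) - 1) := by
        rw [mul_sub, ← Complex.exp_add, mul_one]
        push_cast
        ring_nf
      rw [this, norm_mul, Complex.norm_exp_ofReal_mul_I, one_mul]
      refine (Real.norm_exp_I_mul_ofReal_sub_one_le).trans ?_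
      rw [norm_mul, Real.norm_eq_abs]
    rw [dist_eq_norm, ← integral_sub (hint f) (hint g)]
    calc ‖∫ ω, (Complex.exp (s * f ω * Complex.I) - Complex.exp (s * g ω * Complex.I)) ∂μ‖
        ≤ ∫ ω, |s| * ‖(f - g : Lp ℝ 2 μ) ω‖ ∂μ := by
          refine norm_integral_le_of_norm_le (h1.norm.const_mul _) ?_
          filter_upwards [Lp.coeFn_sub f g] with ω hω
          rw [hω]
          exact hbound _ _
      _ = |s| * ∫ ω, ‖(f - g : Lp ℝ 2 μ) ω‖ ∂μ := integral_const_mul _ _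
      _ ≤ |s| * ‖f - g‖ := by
          refine mul_le_mul_of_nonneg_left ?_ (abs_nonneg s)
          rw [integral_norm_eq_lintegral_enorm h1.1, ← eLpNorm_one_eq_lintegral_enorm, Lp.norm_def]
          exact ENNReal.toReal_mono (Lp.eLpNorm_ne_top _)
            (eLpNorm_le_eLpNorm_of_exponent_le (by norm_num) h1.1)
      _ = _ := by rw [dist_eq_norm, coe_nnnorm, Real.norm_eq_abs]
  exact hlip.continuous.comp X.wienerIntegral.continuous

lemma map_wienerIntegral [IsProbabilityMeasure μ] (X : CenteredGaussianProcess μ T)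
    (h : X.Integrands) : μ.map (X.wienerIntegral h) = gaussianReal 0 (‖h‖ ^ 2).toNNReal := by
  have hm : ∀ h : X.Integrands, AEMeasurable (X.wienerIntegral h) μ := fun h =>
    (Lp.aestronglyMeasurable _).aemeasurable
  have hchar : ∀ (h : X.Integrands) (s : ℝ), charFun (μ.map (X.wienerIntegral h)) s =
      ∫ ω, Complex.exp (s * X.wienerIntegral h ω * Complex.I) ∂μ := by
    intro h s
    rw [charFun_apply_real, integral_map (hm h)]
    exact (by fun_prop : Continuous fun x : ℝ => Complex.exp (s * x * Complex.I)).aestronglyMeasurable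
  have : IsProbabilityMeasure (μ.map (X.wienerIntegral h)) := Measure.isProbabilityMeasure_map (hm h)
  refine Measure.ext_of_charFun (funext fun s => ?_)
  rw [hchar]
  refine congrFun (Continuous.ext_on X.dense_span_indicator
    (X.continuous_integral_exp_wienerIntegral s)
    (g := fun h => charFun (gaussianReal 0 (‖h‖ ^ 2).toNNReal) s) ?_ fun k hk => ?_) h
  · simp_rw [charFun_gaussianReal, Real.coe_toNNReal _ (sq_nonneg _)]
    fun_prop
  · dsimp only
    rw [← hchar, X.map_eq_gaussianReal_of_mem_span hk]

lemma integral_wienerIntegral [IsProbabilityMeasure μ] (X : CenteredGaussianProcess μ T)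
    (h : X.Integrands) : ∫ ω, X.wienerIntegral h ω ∂μ = 0 := by
  have := integral_id_gaussianReal (μ := 0) (v := (‖h‖ ^ 2).toNNReal)
  rw [← X.map_wienerIntegral, integral_map (Lp.aestronglyMeasurable _).aemeasurable
    (by fun_prop)] at this
  exact this

/-- The Wiener integrals of all deterministic integrands are jointly Gaussian. -/
lemma isGaussianProcess_wienerIntegral [IsProbabilityMeasure μ]
    (X : CenteredGaussianProcess μ T) :
    IsGaussianProcess (fun (h : X.Integrands) ω => X.wienerIntegral h ω) μ where
  hasGaussianLaw s := by
    classical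
    have hm : AEMeasurable (fun ω => s.restrict fun h => X.wienerIntegral h ω) μ :=
      aemeasurable_pi_lambda _ fun h => (Lp.aestronglyMeasurable _).aemeasurable
    have : IsProbabilityMeasure (μ.map fun ω => s.restrict fun h => X.wienerIntegral h ω) :=
      Measure.isProbabilityMeasure_map hm
    refine ⟨⟨fun L => ?_⟩⟩
    -- A linear functional of finitely many Wiener integrals is again a Wiener integral, of this
    -- integrand.
    set k : X.Integrands := ∑ h : s, L (Pi.single h 1) • (h : X.Integrands)
    have hk : μ.map (fun ω => L (s.restrict fun h => X.wienerIntegral h ω)) =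
        gaussianReal 0 (‖k‖ ^ 2).toNNReal := by
      rw [← X.map_wienerIntegral]
      refine Measure.map_congr ?_
      have h0 : X.wienerIntegral k =
          ∑ h : s, L (Pi.single h 1) • X.wienerIntegral (h : X.Integrands) := by
        simp [k]
      rw [h0]
      filter_upwards [Lp_coeFn_sum_smul Finset.univ (fun h : s => L (Pi.single h 1))
        fun h => X.wienerIntegral (h : X.Integrands)] with ω hω
      rw [hω]
      refine (LinearMap.pi_apply_eq_sum_univ L.toLinearMap _).trans
        (Finset.sum_congr rfl fun h _ => ?_)
      rw [smul_eq_mul, mul_comm]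
      congr 1
      refine congrArg L (funext fun j => ?_)
      simp [Pi.single_apply, eq_comm]
    have hL : (μ.map fun ω => s.restrict fun h => X.wienerIntegral h ω).map L =
        gaussianReal 0 (‖k‖ ^ 2).toNNReal := by
      rw [AEMeasurable.map_map_of_aemeasurable L.continuous.measurable.aemeasurable hm]
      exact hk
    rw [hL]
    have hG : HasGaussianLaw L (μ.map fun ω => s.restrict fun h => X.wienerIntegral h ω) :=
      ⟨by rw [hL]; infer_instance⟩
    exact hL.symm.trans hG.map_eq_gaussianReal

/-! ### Wick exponentials of Wiener integrals -/

lemma wickExp_wienerIntegral (X : CenteredGaussianProcess μ T) (h : X.Integrands) (ω : Ω) :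
    wickExp μ (X.wienerIntegral h) ω = Real.exp (X.wienerIntegral h ω - ‖h‖ ^ 2 / 2) := by
  rw [wickExp, X.integral_wienerIntegral_sq]
  ring_nf

lemma integrable_exp_wienerIntegral [IsProbabilityMeasure μ] (X : CenteredGaussianProcess μ T)
    (h : X.Integrands) : Integrable (fun ω => Real.exp (X.wienerIntegral h ω)) μ := by
  have h1 := integrable_exp_mul_gaussianReal (μ := 0) (v := (‖h‖ ^ 2).toNNReal) 1
  rw [← X.map_wienerIntegral] at h1
  simpa [Function.comp_def] using h1.comp_aemeasurable (Lp.aestronglyMeasurable _).aemeasurable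

lemma integral_exp_wienerIntegral [IsProbabilityMeasure μ] (X : CenteredGaussianProcess μ T)
    (h : X.Integrands) : ∫ ω, Real.exp (X.wienerIntegral h ω) ∂μ = Real.exp (‖h‖ ^ 2 / 2) := by
  have := mgf_gaussianReal (X.map_wienerIntegral h) 1
  simpa [mgf] using this

/-- The factor `exp ⟨h, k⟩` is the cross term of `‖h + k‖² / 2`. Square integrability, inner
products and conditional expectations of Wick exponentials all come from this rule. -/
lemma wickExp_mul_ae (X : CenteredGaussianProcess μ T) (h k : X.Integrands) :
    (fun ω => wickExp μ (X.wienerIntegral h) ω * wickExp μ (X.wienerIntegral k) ω) =ᵐ[μ]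
      fun ω => Real.exp (inner ℝ h k) * wickExp μ (X.wienerIntegral (h + k)) ω := by
  have h0 : ⇑(X.wienerIntegral (h + k)) =ᵐ[μ] X.wienerIntegral h + X.wienerIntegral k := by
    rw [map_add]
    exact Lp.coeFn_add _ _
  filter_upwards [h0] with ω hω
  simp only [wickExp_wienerIntegral, hω, Pi.add_apply, ← Real.exp_add, norm_add_sq_real]
  ring_nf

lemma integrable_wickExp [IsProbabilityMeasure μ] (X : CenteredGaussianProcess μ T)
    (h : X.Integrands) : Integrable (wickExp μ (X.wienerIntegral h)) μ := by
  refine ((X.integrable_exp_wienerIntegral h).mul_const (Real.exp (-(‖h‖ ^ 2 / 2)))).congr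
    (Filter.Eventually.of_forall fun ω => ?_)
  simp only [wickExp_wienerIntegral, ← Real.exp_add, sub_eq_add_neg]

lemma integral_wickExp [IsProbabilityMeasure μ] (X : CenteredGaussianProcess μ T)
    (h : X.Integrands) : ∫ ω, wickExp μ (X.wienerIntegral h) ω ∂μ = 1 := by
  simp_rw [wickExp_wienerIntegral, sub_eq_add_neg, Real.exp_add]
  rw [integral_mul_const, integral_exp_wienerIntegral, ← Real.exp_add, add_neg_cancel,
    Real.exp_zero]

lemma memLp_wickExp [IsProbabilityMeasure μ] (X : CenteredGaussianProcess μ T)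
    (h : X.Integrands) : MemLp (wickExp μ (X.wienerIntegral h)) 2 μ := by
  refine (memLp_two_iff_integrable_sq (X.integrable_wickExp h).1).2 ?_
  simp_rw [sq]
  exact ((X.integrable_wickExp (h + h)).const_mul _).congr (X.wickExp_mul_ae h h).symm

/-- The Wick exponential of a Wiener integral as an element of `L²`. -/
def wickL2 [IsProbabilityMeasure μ] (X : CenteredGaussianProcess μ T) (h : X.Integrands) :
    Lp ℝ 2 μ :=
  (X.memLp_wickExp h).toLp _

lemma wickL2_ae [IsProbabilityMeasure μ] (X : CenteredGaussianProcess μ T) (h : X.Integrands) :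
    X.wickL2 h =ᵐ[μ] wickExp μ (X.wienerIntegral h) :=
  (X.memLp_wickExp h).coeFn_toLp

lemma inner_wickL2 [IsProbabilityMeasure μ] (X : CenteredGaussianProcess μ T)
    (h k : X.Integrands) : inner ℝ (X.wickL2 h) (X.wickL2 k) = Real.exp (inner ℝ h k) := by
  have h0 : inner ℝ (X.wickL2 h) (X.wickL2 k) =
      ∫ ω, wickExp μ (X.wienerIntegral h) ω * wickExp μ (X.wienerIntegral k) ω ∂μ := by
    rw [L2.inner_def]
    refine integral_congr_ae ?_
    filter_upwards [X.wickL2_ae h, X.wickL2_ae k] with ω h1 h2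
    simp [h1, h2, mul_comm]
  rw [h0, integral_congr_ae (X.wickExp_mul_ae h k), integral_const_mul, integral_wickExp, mul_one]

lemma norm_wickL2 [IsProbabilityMeasure μ] (X : CenteredGaussianProcess μ T)
    (h : X.Integrands) : ‖X.wickL2 h‖ = Real.exp (‖h‖ ^ 2 / 2) := by
  rw [← sq_eq_sq₀ (norm_nonneg _) (Real.exp_nonneg _), ← real_inner_self_eq_norm_sq, inner_wickL2,
    real_inner_self_eq_norm_sq, ← Real.exp_nat_mul]
  ring_nf

lemma sTransform_eq_inner [IsProbabilityMeasure μ] (X : CenteredGaussianProcess μ T)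
    (ξ : Lp ℝ 2 μ) (h : X.Integrands) : X.sTransform ξ h = inner ℝ (X.wickL2 h) ξ := by
  rw [sTransform, L2.inner_def]
  refine integral_congr_ae ?_
  filter_upwards [X.wickL2_ae h] with ω h1
  simp [h1]

/-! ### Measurability with respect to the generated filtration -/

lemma isClosed_lpMeas (X : CenteredGaussianProcess μ T) (r : Set.Icc (0 : ℝ) T) :
    IsClosed (lpMeas ℝ ℝ (X.filtration r) 2 μ : Set (Lp ℝ 2 μ)) :=
  isClosed_aestronglyMeasurable (X.filtration.le r)

lemma measurable_filtration (X : CenteredGaussianProcess μ T) {s t : Set.Icc (0 : ℝ) T}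
    (hst : s ≤ t) : Measurable[X.filtration t] (X.val s) :=
  ((Filtration.stronglyAdapted_natural fun t => (X.measurable t).stronglyMeasurable) s
    |>.mono (X.filtration.mono hst)).measurable

lemma filtration_eq_comap (X : CenteredGaussianProcess μ T) (t : Set.Icc (0 : ℝ) T) :
    X.filtration t = MeasurableSpace.comap (fun ω (s : Set.Iic t) => X.val s ω) inferInstance :=
  Filtration.natural_eq_comap _ _ _

lemma wickL2_mem_lpMeas [IsProbabilityMeasure μ] (X : CenteredGaussianProcess μ T)
    {r : Set.Icc (0 : ℝ) T} {h : X.Integrands}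
    (hh : AEStronglyMeasurable[X.filtration r] (X.wienerIntegral h) μ) :
    X.wickL2 h ∈ lpMeas ℝ ℝ (X.filtration r) 2 μ := by
  rw [mem_lpMeas_iff_aestronglyMeasurable]
  refine AEStronglyMeasurable.congr ?_ (X.wickL2_ae h).symm
  have : Continuous fun x : ℝ => Real.exp (x - ‖h‖ ^ 2 / 2) := by fun_prop
  exact (this.comp_aestronglyMeasurable hh).congr
    (Filter.Eventually.of_forall fun ω => (X.wickExp_wienerIntegral h ω).symm)

/-- The `F_r`-measurable classes form a closed subspace, so it suffices to test on the total family
of indicators. Applied with `B` the identity and with `B` a truncation. -/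
lemma aestronglyMeasurable_wienerIntegral_of_indicator (X : CenteredGaussianProcess μ T)
    (B : X.Integrands →L[ℝ] X.Integrands) {r : Set.Icc (0 : ℝ) T}
    (hB : ∀ t, AEStronglyMeasurable[X.filtration r] (X.wienerIntegral (B (X.indicator t))) μ)
    (h : X.Integrands) : AEStronglyMeasurable[X.filtration r] (X.wienerIntegral (B h)) μ := by
  rw [← mem_lpMeas_iff_aestronglyMeasurable (𝕜 := ℝ)]
  let M := (lpMeas ℝ ℝ (X.filtration r) 2 μ).comap (X.wienerIntegral.comp B).toLinearMap
  have hM : IsClosed (M : Set X.Integrands) :=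
    (X.isClosed_lpMeas r).preimage (X.wienerIntegral.comp B).continuous
  have hsub : Submodule.span ℝ (Set.range X.indicator) ≤ M := by
    rw [Submodule.span_le]
    rintro _ ⟨t, rfl⟩
    exact (mem_lpMeas_iff_aestronglyMeasurable (𝕜 := ℝ)).2 (hB t)
  have := Submodule.topologicalClosure_minimal _ hsub hM
  rw [X.topologicalClosure_span_indicator] at this
  exact this Submodule.mem_top

lemma wickL2_mem_L2X [IsProbabilityMeasure μ] (X : CenteredGaussianProcess μ T)
    (h : X.Integrands) : X.wickL2 h ∈ X.L2X := by
  refine X.wickL2_mem_lpMeas (X.aestronglyMeasurable_wienerIntegral_of_indicator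
    (ContinuousLinearMap.id ℝ _) (fun t => ?_) h)
  exact (X.measurable_filtration t.2.2).stronglyMeasurable.aestronglyMeasurable.congr
    (X.wienerIntegral_indicator_ae t).symm

/-- A Wiener integral that is uncorrelated with `X_s`, `s ≤ r`, is independent of `F_r^X`. -/
lemma indep_filtration [IsProbabilityMeasure μ] (X : CenteredGaussianProcess μ T)
    (r : Set.Icc (0 : ℝ) T) (h : X.Integrands)
    (hh : ∀ s ≤ r, inner ℝ (X.indicator s) h = 0) {f : Ω → ℝ} (hf : Measurable f)
    (hfh : X.wienerIntegral h =ᵐ[μ] f) :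
    Indep (MeasurableSpace.comap f inferInstance) (X.filtration r) μ := by
  let g : Set.Iic r ⊕ Unit → X.Integrands := Sum.elim (fun s => X.indicator s) fun _ => h
  -- The past of `X` and `f` are jointly Gaussian, so zero covariance will give independence.
  have hG : IsGaussianProcess
      (Sum.elim (fun s : Set.Iic r => X.val s) fun _ : Unit => f) μ := by
    refine (X.isGaussianProcess_wienerIntegral.comp_right g).congr ?_
    rintro (s | _)
    · exact X.wienerIntegral_indicator_ae s
    · exact hfh
  have hfI : ∫ ω, f ω ∂μ = 0 := by rw [← integral_congr_ae hfh, X.integral_wienerIntegral]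
  have hf2 : MemLp f 2 μ := (Lp.memLp (X.wienerIntegral h)).ae_eq hfh
  have hind := hG.indepFun_of_covariance_eq_zero (fun s => (X.measurable s).aemeasurable)
    (fun _ => hf.aemeasurable) fun s _ => by
      rw [covariance_eq_sub (X.memLp s) hf2, X.centered, zero_mul, sub_zero]
      refine Eq.trans ?_ ((X.integral_wienerIntegral_mul _ _).trans (hh s s.2))
      refine integral_congr_ae ?_
      filter_upwards [X.wienerIntegral_indicator_ae s, hfh] with ω h1 h2
      simp [h1, h2]
  have hind' := (hind.comp measurable_id (measurable_pi_apply ())).symm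
  rw [X.filtration_eq_comap]
  exact hind'

/-! ### Martingales among centered Gaussian processes -/

/-- Martingales have increments orthogonal to the past; for Gaussian processes such increments are
independent of it, which gives the converse. The martingale property thus becomes geometry of the
integrand space. -/
lemma isMartingale_iff_inner [IsProbabilityMeasure μ] (X : CenteredGaussianProcess μ T) :
    X.IsMartingale ↔ ∀ s r t, s ≤ r → r ≤ t →
      inner ℝ (X.indicator s) (X.indicator t - X.indicator r) = 0 := by
  have hint : ∀ t, Integrable (X.val t) μ := fun t =>
    (X.gaussian.hasGaussianLaw_eval t).integrable
  constructor
  · intro hM s r t hsr hrt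
    have hprod : ∀ t, Integrable (fun ω => X.val s ω * X.val t ω) μ := fun t =>
      (X.memLp s).integrable_mul (X.memLp t)
    have h1 : μ[fun ω => X.val s ω * X.val t ω | X.filtration r] =ᵐ[μ]
        fun ω => X.val s ω * X.val r ω := by
      have := condExp_mul_of_stronglyMeasurable_left (m := X.filtration r)
        (X.measurable_filtration hsr).stronglyMeasurable (hprod t) (hint t)
      filter_upwards [this, hM.2 r t hrt] with ω h1 h2
      refine h1.trans ?_
      rw [Pi.mul_apply, h2]
    rw [inner_sub_right, inner_indicator, inner_indicator, sub_eq_zero, covariance, covariance,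
      ← integral_congr_ae h1, integral_condExp]
  · intro h
    refine ⟨fun t => (X.measurable_filtration le_rfl).stronglyMeasurable, fun r t hrt => ?_⟩
    have hmeas : Measurable (X.val t - X.val r) := (X.measurable t).sub (X.measurable r)
    have hae : X.wienerIntegral (X.indicator t - X.indicator r) =ᵐ[μ] X.val t - X.val r := by
      rw [map_sub]
      filter_upwards [Lp.coeFn_sub (X.wienerIntegral (X.indicator t))
        (X.wienerIntegral (X.indicator r)), X.wienerIntegral_indicator_ae t,
        X.wienerIntegral_indicator_ae r] with ω h1 h2 h3
      rw [h1, Pi.sub_apply, h2, h3, Pi.sub_apply]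
    have hind := X.indep_filtration r (X.indicator t - X.indicator r)
      (fun s hs => h s r t hs hrt) hmeas hae
    have h1 := condExp_indep_eq hmeas.comap_le (X.filtration.le r)
      (comap_measurable _).stronglyMeasurable hind
    have h2 := condExp_sub (hint t) (hint r) (X.filtration r)
    have h3 := condExp_of_stronglyMeasurable (X.filtration.le r)
      (X.measurable_filtration (le_refl r)).stronglyMeasurable (hint r)
    have h4 : ∫ ω, (X.val t - X.val r) ω ∂μ = 0 := by
      rw [← integral_congr_ae hae, X.integral_wienerIntegral]
    rw [h4] at h1
    filter_upwards [h1, h2] with ω h1 h2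
    rw [h2, Pi.sub_apply, h3] at h1
    exact sub_eq_zero.1 h1

/-! ### The truncation operators -/

section Truncation

variable (X : CenteredGaussianProcess μ T) (hX : X.HasIndefiniteWienerIntegral)

/-- If the truncation at `r` is a contraction, then it is orthogonal. -/
lemma inner_indicator_sub_eq_zero_of_contraction {r : Set.Icc (0 : ℝ) T}
    (hA : ∀ h, ‖X.truncation hX r h‖ ≤ ‖h‖) {s t : Set.Icc (0 : ℝ) T} (hsr : s ≤ r) (hrt : r ≤ t) :
    inner ℝ (X.indicator s) (X.indicator t - X.indicator r) = 0 := by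
  set u := X.indicator s
  set v := X.indicator t - X.indicator r
  have hu : X.truncation hX r u = u := by rw [truncation_indicator, min_eq_left hsr]
  have hv : X.truncation hX r v = 0 := by
    simp only [v, map_sub, truncation_indicator, min_eq_right hrt, min_self, sub_self]
  -- The contraction bound at `u + a v`, whose image is `u`. A quadratic in `a` without constant
  -- term stays nonnegative only if its linear coefficient vanishes.
  have key : ∀ a : ℝ, 0 ≤ 2 * a * inner ℝ u v + a ^ 2 * ‖v‖ ^ 2 := by
    intro a
    have h1 := hA (u + a • v)
    rw [map_add, map_smul, hu, hv, smul_zero, add_zero] at h1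
    have h2 := pow_le_pow_left₀ (norm_nonneg _) h1 2
    rw [norm_add_sq_real, inner_smul_right, norm_smul, mul_pow, Real.norm_eq_abs, sq_abs] at h2
    linarith
  have hd : discrim (‖v‖ ^ 2) (2 * inner ℝ u v) 0 ≤ 0 :=
    discrim_le_zero fun a => by linarith [key a, sq a]
  rw [discrim] at hd
  exact pow_eq_zero_iff two_ne_zero |>.1 (le_antisymm (by linarith) (sq_nonneg _))

/-- If the `c`-shifted quasi-conditional expectation at `r` is defined on all of `L²_X`, then the
truncation at `r` is a contraction. -/
lemma norm_truncation_le_of_shiftedDomain_eq [IsProbabilityMeasure μ] {r : Set.Icc (0 : ℝ) T}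
    {c : X.Integrands} (hD : X.shiftedDomain hX r c = X.L2X) (h : X.Integrands) :
    ‖X.truncation hX r h‖ ≤ ‖h‖ := by
  set B := ContinuousLinearMap.adjoint (X.truncation hX r) with hB
  have : CompleteSpace X.L2X := (X.isClosed_lpMeas _).completeSpace_coe
  let w : X.Integrands → X.L2X := fun h => ⟨X.wickL2 (B (h + c) - c), X.wickL2_mem_L2X _⟩
  -- The factor is `1 / ‖e(h)‖`, so that `|g h ξ| ≤ ‖η‖` for every `h` by Cauchy–Schwarz.
  let g : X.Integrands → X.L2X →L[ℝ] ℝ := fun h =>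
    innerSL ℝ (Real.exp (-(‖h‖ ^ 2 / 2)) • w h)
  obtain ⟨C, hC⟩ : ∃ C, ∀ h, ‖g h‖ ≤ C := by
    refine banach_steinhaus fun ξ => ?_
    obtain ⟨-, η, -, hη⟩ : (ξ : Lp ℝ 2 μ) ∈ X.shiftedDomain hX r c := hD ▸ ξ.2
    refine ⟨‖η‖, fun h => ?_⟩
    have h1 : g h ξ = Real.exp (-(‖h‖ ^ 2 / 2)) * inner ℝ (X.wickL2 h) η := by
      rw [← sTransform_eq_inner, ← hη h, sTransform_eq_inner]
      exact real_inner_smul_left (F := X.L2X) (w h) ξ _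
    rw [h1, norm_mul, Real.norm_of_nonneg (Real.exp_nonneg _)]
    calc _ ≤ Real.exp (-(‖h‖ ^ 2 / 2)) * (‖X.wickL2 h‖ * ‖η‖) := by
          gcongr
          exact norm_inner_le_norm _ _
      _ = ‖η‖ := by
          rw [norm_wickL2, ← mul_assoc, ← Real.exp_add, neg_add_cancel, Real.exp_zero, one_mul]
  have hlog : ∀ h : X.Integrands, ‖B h + (B c - c)‖ ^ 2 ≤ ‖h‖ ^ 2 + 2 * Real.log C := by
    intro h
    have h1 : ‖g h‖ = Real.exp (-(‖h‖ ^ 2 / 2) + ‖B (h + c) - c‖ ^ 2 / 2) := by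
      rw [innerSL_apply_norm, norm_smul, Real.norm_of_nonneg (Real.exp_nonneg _), Real.exp_add,
        ← norm_wickL2]
      rfl
    have h2 := hC h
    rw [h1] at h2
    have h3 := (Real.le_log_iff_exp_le ((Real.exp_pos _).trans_le h2)).2 h2
    rw [map_add, add_sub_assoc] at h3
    linarith
  have hBh : ∀ h, ‖B h‖ ≤ ‖h‖ := by
    intro h
    -- Along the ray `a h` the shift `c` enters only the linear and constant terms, so the leading
    -- coefficient must be nonnegative.
    have hbound : ∀ a : ℝ, 0 ≤ (‖h‖ ^ 2 - ‖B h‖ ^ 2) * (a * a) + (-2 * inner ℝ (B h) (B c - c)) * a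
        + (2 * Real.log C - ‖B c - c‖ ^ 2) := by
      intro a
      have h1 := hlog (a • h)
      rw [map_smul, norm_add_sq_real, inner_smul_left, norm_smul, norm_smul, mul_pow, mul_pow,
        Real.norm_eq_abs, sq_abs] at h1
      simp only [conj_trivial] at h1
      linarith [sq a, mul_comm (‖h‖ ^ 2) (a ^ 2)]
    by_contra! hlt
    have hpos : 0 < ‖B h‖ ^ 2 - ‖h‖ ^ 2 := by nlinarith [norm_nonneg h]
    set d := ‖B h‖ ^ 2 - ‖h‖ ^ 2
    set b := inner ℝ (B h) (B c - c)
    set e := 2 * Real.log C - ‖B c - c‖ ^ 2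
    -- Adding the bounds at `±a` cancels the linear term and leaves `d a² ≤ e`. With `a = x + 1` and
    -- `d x = |e| + 1`, already `2 d x > e`, a contradiction.
    have h1 := hbound ((|e| + 1) / d + 1)
    have h2 := hbound (-((|e| + 1) / d + 1))
    have h3 : |e| + 1 = (|e| + 1) / d * d := by field_simp
    set x := (|e| + 1) / d
    have hx : 0 ≤ x := by positivity
    have : ‖h‖ ^ 2 - ‖B h‖ ^ 2 = -d := by simp [d]
    rw [this] at h1 h2
    nlinarith [le_abs_self e, abs_nonneg e, mul_nonneg hx (mul_nonneg hx hpos.le)]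
  have hnorm : ‖X.truncation hX r‖ ≤ 1 := by
    rw [← LinearIsometryEquiv.norm_map ContinuousLinearMap.adjoint, ← hB]
    exact ContinuousLinearMap.opNorm_le_bound _ zero_le_one fun h => by simpa using hBh h
  simpa using (X.truncation hX r).le_of_opNorm_le hnorm h

lemma inner_indicator_eq_of_isMartingale [IsProbabilityMeasure μ] (hM : X.IsMartingale)
    (s t : Set.Icc (0 : ℝ) T) :
    inner ℝ (X.indicator s) (X.indicator t) = ‖X.indicator (min s t)‖ ^ 2 := by
  rw [isMartingale_iff_inner] at hM
  rcases le_total s t with h | h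
  · have := hM s s t le_rfl h
    rw [inner_sub_right, sub_eq_zero] at this
    rw [this, min_eq_left h, real_inner_self_eq_norm_sq]
  · have := hM t t s le_rfl h
    rw [inner_sub_right, sub_eq_zero, real_inner_comm] at this
    rw [this, min_eq_right h, real_inner_self_eq_norm_sq]

/-- The covariance of a martingale depends only on `s ∧ t`, so both bilinear forms equal `‖1_{(0, s
∧ t ∧ r]}‖²` on indicators. -/
lemma adjoint_truncation_of_isMartingale [IsProbabilityMeasure μ] (hM : X.IsMartingale)
    (r : Set.Icc (0 : ℝ) T) :
    ContinuousLinearMap.adjoint (X.truncation hX r) = X.truncation hX r := by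
  refine ContinuousLinearMap.ext_on X.dense_span_indicator ?_
  rintro _ ⟨t, rfl⟩
  refine Dense.eq_of_inner_right ℝ X.dense_span_indicator fun v hv => ?_
  induction hv using Submodule.span_induction with
  | mem x h =>
    obtain ⟨s, rfl⟩ := h
    rw [ContinuousLinearMap.adjoint_inner_right, truncation_indicator, truncation_indicator,
      X.inner_indicator_eq_of_isMartingale hM, X.inner_indicator_eq_of_isMartingale hM,
      min_assoc, min_comm r t]
  | zero => simp
  | add x y _ _ hx hy => rw [inner_add_left, inner_add_left, hx, hy]
  | smul a x _ hx => rw [inner_smul_left, inner_smul_left, hx]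

/-- By orthogonality `e(h) = e(A h) e(h - A h)`; the first factor is `F_r`-measurable, the second is
independent of `F_r` with mean one. -/
lemma condExp_wickL2_of_isMartingale [IsProbabilityMeasure μ] (hM : X.IsMartingale)
    (r : Set.Icc (0 : ℝ) T) (h : X.Integrands) :
    (condExpL2 ℝ ℝ (X.filtration.le r) (X.wickL2 h) : Lp ℝ 2 μ) =
      X.wickL2 (X.truncation hX r h) := by
  set A := X.truncation hX r with hA
  have hAind : ∀ s ≤ r, A (X.indicator s) = X.indicator s := fun s hs => by
    rw [hA, truncation_indicator, min_eq_left hs]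
  have horth : ∀ s ≤ r, inner ℝ (X.indicator s) (h - A h) = 0 := by
    intro s hs
    rw [inner_sub_right, sub_eq_zero, hA, ← X.adjoint_truncation_of_isMartingale hX hM r,
      ContinuousLinearMap.adjoint_inner_right, ← hA, hAind s hs]
  have hAA : inner ℝ (A h) (h - A h) = 0 := by
    refine congrFun (Continuous.ext_on X.dense_span_indicator (f := fun k => inner ℝ (A k) (h - A h))
      (g := fun _ => (0 : ℝ)) (by fun_prop) (by fun_prop) fun k hk => ?_) h
    dsimp only
    induction hk using Submodule.span_induction with
    | mem x hx =>
      obtain ⟨s, rfl⟩ := hx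
      rw [hA, truncation_indicator]
      exact horth _ (min_le_right _ _)
    | zero => simp
    | add x y _ _ hx hy => rw [map_add, inner_add_left, hx, hy, add_zero]
    | smul a x _ hx => rw [map_smul, inner_smul_left, hx, mul_zero]
  have hmeas : AEStronglyMeasurable[X.filtration r] (X.wienerIntegral (A h)) μ := by
    refine X.aestronglyMeasurable_wienerIntegral_of_indicator A (fun t => ?_) h
    rw [hA, truncation_indicator]
    exact (X.measurable_filtration (min_le_right t r)).stronglyMeasurable.aestronglyMeasurable.congr
      (X.wienerIntegral_indicator_ae _).symm
  have hmul : (fun ω => wickExp μ (X.wienerIntegral (A h)) ω *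
      wickExp μ (X.wienerIntegral (h - A h)) ω) =ᵐ[μ] X.wickL2 h := by
    refine (X.wickExp_mul_ae _ _).trans ?_
    rw [hAA, add_sub_cancel]
    simpa using (X.wickL2_ae h).symm
  have hwmeas : AEStronglyMeasurable[X.filtration r] (wickExp μ (X.wienerIntegral (A h))) μ :=
    (mem_lpMeas_iff_aestronglyMeasurable.1 (X.wickL2_mem_lpMeas hmeas)).congr (X.wickL2_ae _)
  have hone : μ[wickExp μ (X.wienerIntegral (h - A h)) | X.filtration r] =ᵐ[μ] fun _ => 1 := by
    -- Independence is stated for a generated σ-algebra, which requires a genuinely measurable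
    -- representative.
    obtain ⟨f, hf, hfae⟩ := (Lp.aestronglyMeasurable (X.wienerIntegral (h - A h))).aemeasurable
    have hind := X.indep_filtration r (h - A h) horth hf hfae
    have hw : wickExp μ (X.wienerIntegral (h - A h)) =ᵐ[μ]
        fun ω => Real.exp (f ω - ‖h - A h‖ ^ 2 / 2) := by
      filter_upwards [hfae] with ω hω
      rw [wickExp_wienerIntegral, hω]
    have hsm : StronglyMeasurable[MeasurableSpace.comap f inferInstance]
        fun ω => Real.exp (f ω - ‖h - A h‖ ^ 2 / 2) :=
      (Real.measurable_exp.comp ((comap_measurable f).sub_const _)).stronglyMeasurable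
    have := condExp_indep_eq hf.comap_le (X.filtration.le r) hsm hind
    rw [← integral_congr_ae hw, X.integral_wickExp] at this
    exact (condExp_congr_ae hw).trans this
  have hcond : μ[X.wickL2 h | X.filtration r] =ᵐ[μ] wickExp μ (X.wienerIntegral (A h)) := by
    refine (condExp_congr_ae hmul.symm).trans ?_
    refine (condExp_mul_of_aestronglyMeasurable_left hwmeas
      ((X.memLp_wickExp _).integrable_mul (X.memLp_wickExp _)) (X.integrable_wickExp _)).trans ?_
    filter_upwards [hone] with ω hω
    rw [Pi.mul_apply, hω, mul_one]
  refine Lp.ext ?_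
  have h1 := MemLp.condExpL2_ae_eq_condExp (𝕜 := ℝ) (X.filtration.le r) (Lp.memLp (X.wickL2 h))
  rw [Lp.toLp_coeFn] at h1
  exact h1.trans (hcond.trans (X.wickL2_ae _).symm)

/-- Without shift, the quasi-conditional expectation is the ordinary one, because conditional
expectation is symmetric on `L²`. -/
lemma shiftedDomain_zero_of_isMartingale [IsProbabilityMeasure μ] (hM : X.IsMartingale)
    (r : Set.Icc (0 : ℝ) T) : X.shiftedDomain hX r 0 = X.L2X := by
  refine Set.Subset.antisymm (fun ξ hξ => hξ.1) fun ξ hξ => ⟨hξ, ?_⟩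
  refine ⟨condExpL2 ℝ ℝ (X.filtration.le r) ξ, ?_, fun h => ?_⟩
  · exact mem_lpMeas_iff_aestronglyMeasurable.2
      ((lpMeas.aestronglyMeasurable (condExpL2 ℝ ℝ (X.filtration.le r) ξ)).mono
        (X.filtration.mono r.2.2))
  · rw [sTransform_eq_inner, sTransform_eq_inner, ← inner_condExpL2_left_eq_right,
      X.condExp_wickL2_of_isMartingale hX hM, X.adjoint_truncation_of_isMartingale hX hM, add_zero,
      sub_zero]

end Truncation

end CenteredGaussianProcess

end

theorem theorem3p5 {Ω : Type*} [MeasurableSpace Ω] (μ : Measure Ω) [IsProbabilityMeasure μ]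
    (T : ℝ) (X : CenteredGaussianProcess μ T) (hX : X.HasIndefiniteWienerIntegral) :
    ¬ X.IsMartingale ↔
      ∀ c : X.Integrands, ∃ r : Set.Icc (0 : ℝ) T,
        X.shiftedDomain hX r c ⊂ (X.L2X : Set (Lp ℝ 2 μ)) := by
  constructor
  · intro hM c
    -- One shift `c` for which no `r` gives a proper domain already forces orthogonality at every
    -- `r`.
    by_contra! hc
    refine hM (X.isMartingale_iff_inner.2 fun s r t hsr hrt => ?_)
    have hD : X.shiftedDomain hX r c = X.L2X :=
      ((show X.shiftedDomain hX r c ⊆ X.L2X from fun ξ hξ => hξ.1).eq_or_ssubset).resolve_right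
        (hc r)
    exact X.inner_indicator_sub_eq_zero_of_contraction hX
      (X.norm_truncation_le_of_shiftedDomain_eq hX hD) hsr hrt
  · intro h hM
    obtain ⟨r, hr⟩ := h 0
    exact hr.ne (X.shiftedDomain_zero_of_isMartingale hX hM r)
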